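/- An index is a finite sequence $\mathbf{k}=(k_1,\dots,k_n)$ of positive integers with $n\ge 1$; its weight is $k_1+\cdots+k_n$, its depth is $n$, its height is the number of $i$ with $k_i\ge 2$, and it is admissible if $k_1\ge 2$. For an admissible index let $\zeta(\mathbf{k})=\sum_{m_1>\cdots>m_n>0} m_1^{-k_1}\cdots m_n^{-k_n}$, and let $t$ be a variable. The interpolated multiple zeta value ($t$-MZV) is $\zeta^t(\mathbf{k})=\sum_{\mathbf{p}} t^{\,n-\mathrm{dep}(\mathbf{p})}\zeta(\mathbf{p})\in\mathbb{R}[t]$, where $\mathbf{p}$ runs over the $2^{n-1}$ sequences $(k_1\,\square\,k_2\,\square\cdots\square\,k_n)$ in which each $\square$ is filled by a comma or a plus sign. For positive integers $k,n,s$ let $X_0(k,n,s)\in\mathbb{R}[t]$ be the sum of $\zeta^t(\mathbf{k})$ over all admissible indices $\mathbf{k}$ of weight $k$, depth $n$ and height $s$. Let $u,w$ be variables, and let $\alpha,\beta,\delta_1,\delta_2$, elements of a commutative ring containing the formal power series ring $\mathbb{R}[t][[u,w]]$, be determined by $$\alpha+\beta=u,\quad \alpha\beta=-tw^2,\qquad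 \delta_1+\delta_2=u,\quad \delta_1\delta_2=(1-t)w^2 .$$ Then for every $n\ge 2$ the element $\alpha^n+\beta^n-\delta_1^n-\delta_2^n$ lies in $\mathbb{R}[t][[u,w]]$, and in $\mathbb{R}[t][[u,w]]$ one has, the sums converging formally, $$\sum_{k\ge 2s,\; s\ge 1} X_0(k,s,s)\,u^{k-2s}w^{2s}=\exp\left[\sum_{n\ge 2}\frac{\zeta(n)}{n}\left(\alpha^n+\beta^n-\delta_1^n-\delta_2^n\right)\right]-1 .$$ In particular, for all integers $n\ge 1$ and $k\ge 2n$, the sum $X_0(k,n,n)$ of all $t$-MZVs of weight $k$ with depth and height both equal to $n$ is a polynomial in the Riemann zeta values $\zeta(m)$, $m\ge 2$, with coefficients in $\mathbb{Q}[t]$. -/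

import Mathlib

open Polynomial

noncomputable section

namespace TMZV

/-! Indices are finite sequences (lists) of positive integers. -/

/-- An index is admissible if it is non-empty and its first entry is at least `2`. -/
def Admissible (k : List ℕ) : Prop := ∃ a l, k = a :: l ∧ 2 ≤ a

/-- The height: the number of entries that are at least `2`. -/
def height (k : List ℕ) : ℕ := k.countP (fun a => decide (2 ≤ a))

/-- The multiple zeta value
`ζ(k₁, …, kₙ) = ∑_{m₁ > m₂ > ⋯ > mₙ > 0} 1 / (m₁^k₁ ⋯ mₙ^kₙ)`.
The series converges (absolutely) for every admissible sequence of positive integers. -/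
def mzv (k : List ℕ) : ℝ :=
  ∑' m : {m : Fin k.length → ℕ // StrictAnti m ∧ ∀ i, 0 < m i},
    ∏ i, 1 / ((m.1 i : ℝ) ^ (k.get i))

/-- `fillings a [b₁, …, bᵣ]` lists the `2 ^ r` sequences `(a □ b₁ □ ⋯ □ bᵣ)` obtained by filling
each box by a comma (first summand below) or by a plus (second summand). -/
def fillings : ℕ → List ℕ → List (List ℕ)
  | a, [] => [[a]]
  | a, b :: l => (fillings b l).map (fun p => a :: p) ++ fillings (a + b) l

/-- The interpolated multiple zeta value `ζᵗ(k₁, …, kₙ) = ∑_p t ^ (n - dep p) ζ(p)`, a polynomial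
in the variable `t = X`, where `p` runs over all `(k₁ □ k₂ □ ⋯ □ kₙ)`. (The empty sequence is not
an index; it is given the value `0`.) -/
def tmzv : List ℕ → ℝ[X]
  | [] => 0
  | a :: l => ((fillings a l).map
      (fun p => X ^ ((a :: l).length - p.length) * C (mzv p))).sum

open Classical in
/-- `X₀(k, n, s)`: the sum of `ζᵗ` over all admissible indices of weight `k`, depth `n` and
height `s`. (A `Composition k` is a finite sequence of positive integers with sum `k`.) -/
def X₀ (k n s : ℕ) : ℝ[X] :=
  ∑ c : Composition k with
    Admissible c.blocks ∧ c.blocks.length = n ∧ height c.blocks = s, tmzv c.blocks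

/-- The value `ζ(n)` of the Riemann zeta function as a real number. -/
def zetaVal (n : ℕ) : ℝ := (riemannZeta (n : ℂ)).re

/-- For `n ≥ 2` no information is lost by taking the real part. -/
theorem ofReal_zetaVal {n : ℕ} (hn : 2 ≤ n) : ((zetaVal n : ℝ) : ℂ) = riemannZeta (n : ℂ) := by
  have h : riemannZeta (n : ℂ) = ((∑' m : ℕ, 1 / (m : ℝ) ^ n : ℝ) : ℂ) := by
    rw [zeta_nat_eq_tsum_of_gt_one (by omega)]
    push_cast
    rfl
  rw [zetaVal, h, Complex.ofReal_re]

/-- The ring `ℝ[t][[u, w]]` of formal power series in two variables `u`, `w` over `ℝ[t]`. -/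
abbrev Ser : Type := MvPowerSeries (Fin 2) ℝ[X]

/-- The variable `u`. -/
def u : Ser := MvPowerSeries.X 0

/-- The variable `w`. -/
def w : Ser := MvPowerSeries.X 1

/-- The elements of `ℝ[t]` as constant power series. -/
def const (p : ℝ[X]) : Ser := MvPowerSeries.C p

/-- The variable `t`. -/
def t : Ser := const X

/-- Summation of a family of formal power series: every monomial receives a contribution from
only finitely many members of the family `f`, and the contributions add up to the coefficient
in `g`. -/
def FormalHasSum {ι : Type*} (f : ι → Ser) (g : Ser) : Prop :=
  ∀ e : Fin 2 →₀ ℕ, (Function.support fun i => MvPowerSeries.coeff e (f i)).Finite ∧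
    ∑ᶠ i, MvPowerSeries.coeff e (f i) = MvPowerSeries.coeff e g

/-- The exponential `∑ Lʲ / j!` of a formal power series `L` (without constant term). -/
def fexp (L : Ser) : Ser := (PowerSeries.exp ℝ[X]).subst L

end TMZV

end

/-! Depth equal to height means that every entry is at least 2. Let `G_M` be the generating series
of the interpolated values of all such sequences, the empty one included, with summation variables
at most `M`, and put `x = 1/(M+1)`. Let `T` be the part of `G_{M+1}` whose largest variable equals
`M+1`. Removing the first entry `a ≥ 2` leaves either a sum truncated at `M` (comma) or, with a
factor `t`, again a term of `T` (plus). Summing the geometric series over `a` gives `(1 - xu) T =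
x²w² (G_M + t T)`, that is, `(1 - xu - t x²w²) G_{M+1} = (1 - xu + (1-t) x²w²) G_M`
(`quad_mul_gen_succ`). Hence `G_M` is the product over `m ≤ M` of `(1-δ₁/m)(1-δ₂/m) /
((1-α/m)(1-β/m))`, and the formula is its logarithm as `M → ∞`.

The logarithm is replaced by the Euler derivation `D`, which makes sense without adjoining roots.
The recursion yields `D G_M = G_M · truncDiff M` (`eulerD_gen_truncTmzv`), in which the power sums
`∑ m⁻ⁿ` multiply `αⁿ + βⁿ - δ₁ⁿ - δ₂ⁿ`. These differences vanish for `n < 2`, so every coefficient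
converges (`eulerD_gen_tmzvOne`). The exponential solves the limiting equation with the same
constant term, and the solution is unique (`eq_of_eulerD_eq_mul`). -/

noncomputable section

namespace TMZV

/-! ### The Euler derivation on power series. -/

section Euler

variable {σ R : Type*} [CommRing R]

/-- The Euler derivation, multiplying the part of degree `n` by `n`. -/
def eulerD (F : MvPowerSeries σ R) : MvPowerSeries σ R :=
  fun e => (e.degree : R) * MvPowerSeries.coeff e F

theorem coeff_eulerD (F : MvPowerSeries σ R) (e : σ →₀ ℕ) :
    MvPowerSeries.coeff e (eulerD F) = (e.degree : R) * MvPowerSeries.coeff e F := rfl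

theorem eulerD_add (F G : MvPowerSeries σ R) : eulerD (F + G) = eulerD F + eulerD G := by
  ext e
  simp only [coeff_eulerD, map_add, mul_add]

theorem eulerD_sub (F G : MvPowerSeries σ R) : eulerD (F - G) = eulerD F - eulerD G := by
  ext e
  simp only [coeff_eulerD, map_sub, mul_sub]

theorem eulerD_mul (F G : MvPowerSeries σ R) :
    eulerD (F * G) = eulerD F * G + F * eulerD G := by
  classical
  ext e
  simp only [coeff_eulerD, map_add, MvPowerSeries.coeff_mul, Finset.mul_sum,
    ← Finset.sum_add_distrib]
  refine Finset.sum_congr rfl fun p hp => ?_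
  rw [← Finset.HasAntidiagonal.mem_antidiagonal.1 hp, map_add]
  push_cast
  ring

theorem eulerD_C (r : R) : eulerD (MvPowerSeries.C r : MvPowerSeries σ R) = 0 := by
  classical
  ext e
  rw [coeff_eulerD, MvPowerSeries.coeff_C]
  split_ifs with h
  · simp [h]
  · simp

theorem eulerD_one : eulerD (1 : MvPowerSeries σ R) = 0 := by
  simpa using eulerD_C (σ := σ) (1 : R)

theorem eulerD_X (s : σ) : eulerD (MvPowerSeries.X s : MvPowerSeries σ R) = MvPowerSeries.X s := by
  classical
  ext e
  rw [coeff_eulerD, MvPowerSeries.coeff_X]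
  split_ifs with h
  · simp [h, Finsupp.degree_single]
  · simp

theorem eulerD_pow_succ (F : MvPowerSeries σ R) (d : ℕ) :
    eulerD (F ^ (d + 1)) = ((d + 1 : ℕ) : MvPowerSeries σ R) * F ^ d * eulerD F := by
  induction d with
  | zero => simp
  | succ d ih =>
    rw [pow_succ, eulerD_mul, ih]
    push_cast
    ring

/-- A logarithmic differential equation for the Euler derivation has at most one solution with a
given constant term. -/
theorem eq_of_eulerD_eq_mul [IsDomain R] [CharZero R] {F G E : MvPowerSeries σ R}
    (hE : MvPowerSeries.constantCoeff E = 0)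
    (h0 : MvPowerSeries.constantCoeff F = MvPowerSeries.constantCoeff G)
    (hF : eulerD F = F * E) (hG : eulerD G = G * E) : F = G := by
  classical
  have hH : eulerD (F - G) = (F - G) * E := by rw [eulerD_sub, hF, hG, sub_mul]
  suffices h : ∀ n, ∀ e : σ →₀ ℕ, e.degree = n → MvPowerSeries.coeff e (F - G) = 0 by
    rw [← sub_eq_zero]
    ext e
    exact h _ e rfl
  intro n
  induction n using Nat.strong_induction_on with
  | _ n ih =>
    intro e he
    by_cases h : e = 0
    · subst h
      simpa [sub_eq_zero] using h0
    · have h1 := congrArg (MvPowerSeries.coeff e) hH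
      rw [coeff_eulerD, MvPowerSeries.coeff_mul, Finset.sum_eq_zero] at h1
      · refine (mul_eq_zero.1 h1).resolve_left ?_
        rwa [Nat.cast_eq_zero, Finsupp.degree_eq_zero_iff]
      · rintro ⟨a, b⟩ hab
        rw [Finset.HasAntidiagonal.mem_antidiagonal] at hab
        by_cases hb : b = 0
        · subst hb
          simp [hE]
        · have hb' : b.degree ≠ 0 := by rwa [Ne, Finsupp.degree_eq_zero_iff]
          have hab' : a.degree + b.degree = n := by rw [← map_add, hab, he]
          rw [ih a.degree (by omega) a rfl, zero_mul]

end Euler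

/-! ### The exponential of a power series. -/

theorem hasSubst_of_constantCoeff {L : Ser} (hL : MvPowerSeries.constantCoeff L = 0) :
    PowerSeries.HasSubst L :=
  PowerSeries.HasSubst.of_constantCoeff_zero hL

theorem coeff_pow_eq_zero {L : Ser} (hL : MvPowerSeries.constantCoeff L = 0) {e : Fin 2 →₀ ℕ}
    {d : ℕ} (h : e.degree < d) : MvPowerSeries.coeff e (L ^ d) = 0 := by
  apply MvPowerSeries.coeff_of_lt_order
  refine lt_of_lt_of_le ?_ (MvPowerSeries.le_order_pow_of_constantCoeff_eq_zero d hL)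
  exact_mod_cast h

/-- A partial sum of the exponential series. -/
def expPartial (L : Ser) (N : ℕ) : Ser :=
  ∑ d ∈ Finset.range N, const (C ((d.factorial : ℝ)⁻¹)) * L ^ d

/-- `L ^ d` has no terms of degree below `d`, so in each degree the exponential is a finite sum. -/
theorem coeff_fexp {L : Ser} (hL : MvPowerSeries.constantCoeff L = 0) {e : Fin 2 →₀ ℕ} {N : ℕ}
    (hN : e.degree < N) :
    MvPowerSeries.coeff e (fexp L) = MvPowerSeries.coeff e (expPartial L N) := by
  rw [fexp, PowerSeries.coeff_subst (hasSubst_of_constantCoeff hL), expPartial, map_sum,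
    finsum_eq_sum_of_support_subset (s := Finset.range N)]
  · refine Finset.sum_congr rfl fun d _ => ?_
    rw [const, MvPowerSeries.coeff_C_mul, PowerSeries.coeff_exp, smul_eq_mul]
    simp [Polynomial.algebraMap_eq, IsScalarTower.algebraMap_apply ℚ ℝ ℝ[X]]
  · intro d hd
    by_contra h
    refine hd ?_
    simp only [Finset.coe_range, Set.mem_Iio, not_lt] at h
    simp only [coeff_pow_eq_zero hL (lt_of_lt_of_le hN h), smul_zero]

theorem constantCoeff_fexp {L : Ser} (hL : MvPowerSeries.constantCoeff L = 0) :
    MvPowerSeries.constantCoeff (fexp L) = 1 := by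
  rw [← MvPowerSeries.coeff_zero_eq_constantCoeff_apply,
    coeff_fexp hL (N := 1) (by simp)]
  simp [expPartial, const]

theorem eulerD_expPartial (L : Ser) (N : ℕ) :
    eulerD (expPartial L (N + 1)) = expPartial L N * eulerD L := by
  induction N with
  | zero => simp [expPartial, const, eulerD_one]
  | succ N ih =>
    rw [expPartial, Finset.sum_range_succ, eulerD_add, ← expPartial, ih, expPartial, expPartial,
      Finset.sum_range_succ, add_mul, const, const, eulerD_mul, eulerD_C, eulerD_pow_succ]
    have h : (MvPowerSeries.C (C (((N + 1).factorial : ℝ)⁻¹)) : Ser) * ((N + 1 : ℕ) : Ser)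
        = MvPowerSeries.C (C ((N.factorial : ℝ)⁻¹)) := by
      rw [← map_natCast (MvPowerSeries.C (σ := Fin 2) (R := ℝ[X])), ← map_mul,
        ← map_natCast (C (R := ℝ)), ← map_mul]
      congr 2
      rw [Nat.factorial_succ]
      push_cast
      field_simp
    rw [← h]
    ring

theorem eulerD_fexp {L : Ser} (hL : MvPowerSeries.constantCoeff L = 0) :
    eulerD (fexp L) = fexp L * eulerD L := by
  classical
  ext1 e
  -- Differentiation costs one term of the partial sum; the `e.degree + 1` terms that remain still
  -- determine all coefficients up to degree `e.degree`.
  rw [coeff_eulerD, coeff_fexp hL (N := e.degree + 1 + 1) (by omega), ← coeff_eulerD,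
    eulerD_expPartial, MvPowerSeries.coeff_mul, MvPowerSeries.coeff_mul]
  refine Finset.sum_congr rfl fun p hp => ?_
  rw [coeff_fexp hL (N := e.degree + 1)]
  rw [← Finset.HasAntidiagonal.mem_antidiagonal.1 hp, map_add]
  omega

/-! ### Graded series, power sums and quadratic factors. -/

/-- The series whose part of degree `n` is the part of degree `n` of `f n`. -/
def graded (f : ℕ → Ser) : Ser := fun e => MvPowerSeries.coeff e (f e.degree)

theorem coeff_graded (f : ℕ → Ser) (e : Fin 2 →₀ ℕ) :
    MvPowerSeries.coeff e (graded f) = MvPowerSeries.coeff e (f e.degree) := rfl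

/-- The coefficients in degrees other than `n` vanish. -/
def IsHomog (n : ℕ) (F : Ser) : Prop := ∀ e : Fin 2 →₀ ℕ, e.degree ≠ n → MvPowerSeries.coeff e F = 0

theorem IsHomog.add {n : ℕ} {F G : Ser} (hF : IsHomog n F) (hG : IsHomog n G) :
    IsHomog n (F + G) := fun e he => by rw [map_add, hF e he, hG e he, add_zero]

theorem IsHomog.sub {n : ℕ} {F G : Ser} (hF : IsHomog n F) (hG : IsHomog n G) :
    IsHomog n (F - G) := fun e he => by rw [map_sub, hF e he, hG e he, sub_zero]

theorem IsHomog.mul {n m : ℕ} {F G : Ser} (hF : IsHomog n F) (hG : IsHomog m G) :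
    IsHomog (n + m) (F * G) := by
  classical
  intro e he
  rw [MvPowerSeries.coeff_mul]
  refine Finset.sum_eq_zero fun p hp => ?_
  by_cases h1 : p.1.degree = n
  · rw [hG p.2, mul_zero]
    intro h2
    rw [← Finset.HasAntidiagonal.mem_antidiagonal.1 hp, map_add] at he
    omega
  · rw [hF _ h1, zero_mul]

theorem isHomog_const (p : ℝ[X]) : IsHomog 0 (const p) := fun e he => by
  rw [const, MvPowerSeries.coeff_C_of_ne_zero]
  rintro rfl
  simp at he

theorem isHomog_X (s : Fin 2) : IsHomog 1 (MvPowerSeries.X s) := fun e he => by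
  classical
  rw [MvPowerSeries.coeff_X, if_neg]
  rintro rfl
  simp [Finsupp.degree_single] at he

theorem isHomog_u : IsHomog 1 u := isHomog_X 0

theorem isHomog_const_mul_w_sq (p : ℝ[X]) : IsHomog 2 (const p * w ^ 2) := by
  have h : IsHomog 1 w := isHomog_X 1
  simpa [pow_two] using (isHomog_const p).mul (h.mul h)

/-- Multiplication of a graded series by a homogeneous one. -/
theorem IsHomog.mul_graded {m : ℕ} {G : Ser} (hG : IsHomog m G) (f : ℕ → Ser) :
    G * graded f = graded fun n => if m ≤ n then G * f (n - m) else 0 := by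
  classical
  ext1 e
  rw [coeff_graded]
  split_ifs with h
  · rw [MvPowerSeries.coeff_mul, MvPowerSeries.coeff_mul]
    refine Finset.sum_congr rfl fun p hp => ?_
    by_cases h1 : p.1.degree = m
    · rw [coeff_graded]
      congr 3
      rw [← Finset.HasAntidiagonal.mem_antidiagonal.1 hp, map_add]
      omega
    · rw [hG _ h1, zero_mul, zero_mul]
  · rw [MvPowerSeries.coeff_mul, map_zero]
    refine Finset.sum_eq_zero fun p hp => ?_
    rw [hG, zero_mul]
    rw [← Finset.HasAntidiagonal.mem_antidiagonal.1 hp, map_add] at h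
    omega

theorem graded_sub (f g : ℕ → Ser) : graded (fun n => f n - g n) = graded f - graded g := by
  ext1 e
  simp [coeff_graded]

/-- The power sums of two quantities with sum `u` and product `-p w²`. -/
def powSum (p : ℝ[X]) : ℕ → Ser
  | 0 => 2
  | 1 => u
  | n + 2 => u * powSum p (n + 1) + const p * w ^ 2 * powSum p n

/-- Newton's recursion: both roots satisfy `z² = u z + p w²`. This is why the power sums already
live in `Ser`. -/
theorem map_powSum {B : Type*} [CommRing B] [Algebra Ser B] (p : ℝ[X]) {α β : B}
    (hs : α + β = algebraMap Ser B u) (hp : α * β = algebraMap Ser B (-(const p * w ^ 2))) (n : ℕ) :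
    algebraMap Ser B (powSum p n) = α ^ n + β ^ n := by
  induction n using Nat.twoStepInduction with
  | zero =>
    rw [powSum, pow_zero, pow_zero, map_ofNat, one_add_one_eq_two]
  | one => simp [powSum, hs]
  | more n h1 h2 =>
    rw [map_neg] at hp
    rw [powSum, map_add, map_mul, h2, map_mul, h1, ← hs, ← neg_eq_iff_eq_neg.2 hp]
    ring

theorem isHomog_powSum (p : ℝ[X]) (n : ℕ) : IsHomog n (powSum p n) := by
  induction n using Nat.twoStepInduction with
  | zero =>
    have := isHomog_const 2
    rwa [const, map_ofNat] at this
  | one => exact isHomog_u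
  | more n h1 h2 =>
    rw [powSum]
    refine IsHomog.add ?_ ?_
    · rw [show n + 2 = 1 + (n + 1) by ring]
      exact isHomog_u.mul h2
    · rw [show n + 2 = 2 + n by ring]
      exact (isHomog_const_mul_w_sq p).mul h1

/-- The generating series of power sums, scaled by a real number `x`. -/
def powSumSeries (p : ℝ[X]) (x : ℝ) : Ser := graded fun n => const (C (x ^ n)) * powSum p n

theorem const_mul (p q : ℝ[X]) : const (p * q) = const p * const q := map_mul _ _ _

/-- The quadratic polynomial `1 - x u - p x² w²`. -/
def quad (p : ℝ[X]) (x : ℝ) : Ser := 1 - const (C x) * u - const (C x) ^ 2 * (const p * w ^ 2)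

/-- With roots `α`, `β` the series is `1/(1-αx) + 1/(1-βx)` and `quad p x = (1-αx)(1-βx)`. Without
roots, the recursion cancels everything in degrees at least 2. -/
theorem quad_mul_powSumSeries (p : ℝ[X]) (x : ℝ) :
    quad p x * powSumSeries p x = 2 - const (C x) * u := by
  have hu : IsHomog 1 (const (C x) * u) := by simpa using (isHomog_const (C x)).mul isHomog_u
  have hw : IsHomog 2 (const (C x) ^ 2 * (const p * w ^ 2)) := by
    have := (isHomog_const (C x ^ 2)).mul (isHomog_const_mul_w_sq p)
    simpa [const, map_pow] using this
  have h2 : IsHomog 0 (2 : Ser) := isHomog_powSum p 0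
  have hx : ∀ n, const (C (x ^ n)) = const (C x) ^ n := fun n => by simp [const]
  have hR : (2 : Ser) - const (C x) * u
      = graded fun n => if n = 0 then 2 else if n = 1 then - (const (C x) * u) else 0 := by
    ext1 e
    rw [coeff_graded, map_sub]
    split_ifs with h0 h1
    · rw [hu e (by omega), sub_zero]
    · rw [h2 e (by omega), map_neg, zero_sub]
    · rw [h2 e h0, hu e h1, sub_zero, map_zero]
  rw [hR, powSumSeries, quad, sub_mul, sub_mul, one_mul, hu.mul_graded, hw.mul_graded,
    ← graded_sub, ← graded_sub]
  congr 1
  funext n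
  match n with
  | 0 => simp [powSum, const]
  | 1 =>
    have h1 : const 1 = 1 := map_one _
    simp [h1, powSum]
    ring
  | n + 2 =>
    simp only [hx, powSum]
    simp
    ring

/-- This is the logarithmic derivative: `α` has degree 1, so `D(1-αx) = -αx = (1-αx)(1 - 1/(1-αx))`,
and likewise for `β`. -/
theorem eulerD_quad (p : ℝ[X]) (x : ℝ) :
    eulerD (quad p x) = quad p x * (2 - powSumSeries p x) := by
  have hc : ∀ q : ℝ[X], eulerD (const q) = 0 := fun q => eulerD_C q
  have hu : eulerD u = u := eulerD_X 0
  have hw : eulerD w = w := eulerD_X 1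
  rw [mul_sub, quad_mul_powSumSeries]
  simp only [quad, eulerD_sub, eulerD_mul, pow_two, hc, hu, hw, eulerD_one]
  ring

theorem constantCoeff_quad (p : ℝ[X]) (x : ℝ) : MvPowerSeries.constantCoeff (quad p x) = 1 := by
  simp [quad, u, w]

theorem quad_ne_zero (p : ℝ[X]) (x : ℝ) : quad p x ≠ 0 := fun h => by
  have := constantCoeff_quad p x
  simp [h] at this

/-- The difference of power sums `αⁿ + βⁿ - δ₁ⁿ - δ₂ⁿ`. -/
def powDiff (n : ℕ) : Ser := powSum X n - powSum (X - 1) n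

theorem powDiff_zero : powDiff 0 = 0 := sub_self _

theorem powDiff_one : powDiff 1 = 0 := sub_self _

theorem isHomog_powDiff (n : ℕ) : IsHomog n (powDiff n) :=
  (isHomog_powSum _ n).sub (isHomog_powSum _ n)

/-- Multiplying by the quotient of two quadratic polynomials adds a logarithmic derivative. -/
theorem eulerD_of_quad_mul_eq {x : ℝ} {Z Z' E : Ser} (hZ : eulerD Z = Z * E)
    (h : quad X x * Z' = quad (X - 1) x * Z) :
    eulerD Z' = Z' * (E + (powSumSeries X x - powSumSeries (X - 1) x)) := by
  have h1 := congrArg eulerD h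
  rw [eulerD_mul, eulerD_mul, eulerD_quad, eulerD_quad, hZ] at h1
  refine mul_left_cancel₀ (quad_ne_zero X x) ?_
  linear_combination h1 - (2 - powSumSeries (X - 1) x + E) * h

/-! ### Truncated interpolated values and their recursion. -/

/-- The multiple zeta sum truncated to summation variables at most `M`. -/
def truncMzv : List ℕ → ℕ → ℝ
  | [], _ => 1
  | k :: l, M => ∑ m ∈ Finset.range M, ((m : ℝ) + 1)⁻¹ ^ k * truncMzv l m

theorem truncMzv_cons_succ (k : ℕ) (l : List ℕ) (M : ℕ) :
    truncMzv (k :: l) (M + 1) = truncMzv (k :: l) M + ((M : ℝ) + 1)⁻¹ ^ k * truncMzv l M := by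
  simp only [truncMzv, Finset.sum_range_succ]

theorem length_le_of_mem_fillings {l : List ℕ} {a : ℕ} {p : List ℕ} (hp : p ∈ fillings a l) :
    p.length ≤ l.length + 1 := by
  induction l generalizing a p with
  | nil => simp_all [fillings]
  | cons b l ih =>
    rw [fillings, List.mem_append, List.mem_map] at hp
    rcases hp with ⟨q, hq, rfl⟩ | hp
    · simpa using ih hq
    · exact (ih hp).trans (by simp)

/-- The interpolation in `t` of a function `ψ` on sequences. -/
def fillSum (ψ : List ℕ → ℝ) (a : ℕ) (l : List ℕ) : ℝ[X] :=
  ((fillings a l).map (fun p => X ^ ((a :: l).length - p.length) * C (ψ p))).sum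

theorem fillSum_nil (ψ : List ℕ → ℝ) (a : ℕ) : fillSum ψ a [] = C (ψ [a]) := by
  simp [fillSum, fillings]

theorem fillSum_cons (ψ : List ℕ → ℝ) (a b : ℕ) (l : List ℕ) :
    fillSum ψ a (b :: l) = fillSum (fun p => ψ (a :: p)) b l + X * fillSum ψ (a + b) l := by
  rw [fillSum, fillings, List.map_append, List.sum_append, List.map_map, fillSum, fillSum,
    ← List.sum_map_mul_left]
  congr 2
  · refine List.map_congr_left fun p _ => ?_
    simp
  · refine List.map_congr_left fun p hp => ?_
    have := length_le_of_mem_fillings hp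
    rw [← mul_assoc, ← pow_succ']
    congr 2
    simp only [List.length_cons]
    omega

theorem fillSum_const_mul {ψ ψ' : List ℕ → ℝ} {c : ℝ} (h : ∀ p, ψ p = c * ψ' p) (a : ℕ)
    (l : List ℕ) : fillSum ψ a l = C c * fillSum ψ' a l := by
  rw [fillSum, fillSum, ← List.sum_map_mul_left]
  congr 1
  refine List.map_congr_left fun p _ => ?_
  rw [h, map_mul]
  ring

theorem fillSum_add (ψ ψ' : List ℕ → ℝ) (a : ℕ) (l : List ℕ) :
    fillSum (fun p => ψ p + ψ' p) a l = fillSum ψ a l + fillSum ψ' a l := by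
  rw [fillSum, fillSum, fillSum, ← List.sum_map_add]
  simp only [map_add, mul_add]

/-- Adding `a` to the first entry changes only the first block of each filling, so a weight that is
multiplicative in that block releases a common factor. -/
theorem fillSum_shift {c : ℝ} {a : ℕ} {ψ ψ' : List ℕ → ℝ}
    (h : ∀ b p, ψ ((a + b) :: p) = c * ψ' (b :: p)) (b : ℕ) (l : List ℕ) :
    fillSum ψ (a + b) l = C c * fillSum ψ' b l := by
  induction l generalizing b with
  | nil => simp [fillSum_nil, h]
  | cons d l ih =>
    rw [fillSum_cons, fillSum_cons, fillSum_const_mul (h b), add_assoc, ih]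
    ring

/-- The truncated interpolated multiple zeta values. -/
def truncTmzv (M : ℕ) : List ℕ → ℝ[X]
  | [] => 1
  | a :: l => fillSum (fun p => truncMzv p M) a l

/-- The part of `truncTmzv (M + 1)` in which the largest summation variable is `M + 1`. -/
def topTmzv (M : ℕ) : List ℕ → ℝ[X]
  | [] => 0
  | a :: l => fillSum (fun p => ((M : ℝ) + 1)⁻¹ ^ p.headD 0 * truncMzv p.tail M) a l

/-- Fillings are never empty, so the value of `ψ` at `[]` is irrelevant. -/
theorem fillSum_congr {ψ ψ' : List ℕ → ℝ} (h : ∀ a p, ψ (a :: p) = ψ' (a :: p)) (a : ℕ)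
    (l : List ℕ) : fillSum ψ a l = fillSum ψ' a l := by
  have := fillSum_shift (c := 1) (a := 0) (ψ := ψ) (ψ' := ψ') (by simpa using h) a l
  simpa using this

theorem truncTmzv_succ (M : ℕ) (l : List ℕ) :
    truncTmzv (M + 1) l = truncTmzv M l + topTmzv M l := by
  cases l with
  | nil => simp [truncTmzv, topTmzv]
  | cons a l =>
    rw [truncTmzv, truncTmzv, topTmzv, ← fillSum_add]
    refine fillSum_congr (fun b p => ?_) a l
    rw [truncMzv_cons_succ, List.headD_cons, List.tail_cons]

/-- A comma in the first box forces the later variables below `M + 1`; a plus merges the next entry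
into the top block at the price of `X`. The values 1 and 0 at `[]` make this valid for depth one
too. -/
theorem topTmzv_cons (M a : ℕ) (l : List ℕ) :
    topTmzv M (a :: l)
      = C (((M : ℝ) + 1)⁻¹ ^ a) * (truncTmzv M l + X * topTmzv M l) := by
  cases l with
  | nil => simp [topTmzv, truncTmzv, fillSum_nil, truncMzv]
  | cons b l =>
    rw [topTmzv, fillSum_cons, fillSum_shift (c := ((M : ℝ) + 1)⁻¹ ^ a)
      (ψ' := fun p => ((M : ℝ) + 1)⁻¹ ^ p.headD 0 * truncMzv p.tail M), ← topTmzv,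
      fillSum_const_mul (c := ((M : ℝ) + 1)⁻¹ ^ a) (ψ' := fun p => truncMzv p M), ← truncTmzv]
    · ring
    · intro p
      simp
    · intro d p
      simp only [List.headD_cons, List.tail_cons]
      ring

/-! ### Generating series over sequences with entries at least 2. -/

/-- The sequences of length `s` with entries at least `2` and sum `n + 2 s`. -/
def idx : ℕ → ℕ → Finset (List ℕ)
  | 0, n => if n = 0 then {[]} else ∅
  | s + 1, n => (Finset.HasAntidiagonal.antidiagonal n).biUnion fun q => (idx s q.2).image (List.cons (q.1 + 2))

theorem mem_idx {s n : ℕ} {l : List ℕ} :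
    l ∈ idx s n ↔ l.length = s ∧ l.sum = n + 2 * s ∧ ∀ a ∈ l, 2 ≤ a := by
  induction s generalizing n l with
  | zero =>
    rw [idx]
    split_ifs with h
    · subst h
      rw [Finset.mem_singleton, List.length_eq_zero_iff]
      constructor
      · rintro rfl
        simp
      · exact fun h => h.1
    · simp only [Finset.notMem_empty, List.length_eq_zero_iff, false_iff]
      rintro ⟨rfl, h2, -⟩
      simp at h2
      omega
  | succ s ih =>
    simp only [idx, Finset.mem_biUnion, Finset.mem_image, ih, Prod.exists,
      Finset.HasAntidiagonal.mem_antidiagonal]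
    constructor
    · rintro ⟨i, j, rfl, l, ⟨rfl, h2, h3⟩, rfl⟩
      refine ⟨rfl, ?_, ?_⟩
      · rw [List.sum_cons, h2]
        ring
      · simpa using h3
    · rintro ⟨h1, h2, h3⟩
      cases l with
      | nil => simp at h1
      | cons a l =>
        simp only [List.length_cons, List.sum_cons, List.mem_cons, forall_eq_or_imp,
          Nat.add_right_cancel_iff] at h1 h2 h3
        have hl : l.length * 2 ≤ l.sum := by
          simpa using List.card_nsmul_le_sum l 2 h3.2
        refine ⟨a - 2, l.sum - 2 * s, by omega, l, ⟨h1, by omega, h3.2⟩, ?_⟩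
        rw [Nat.sub_add_cancel h3.1]

theorem sum_idx_succ {R : Type*} [AddCommMonoid R] (f : List ℕ → R) (s n : ℕ) :
    ∑ l ∈ idx (s + 1) n, f l
      = ∑ q ∈ Finset.HasAntidiagonal.antidiagonal n, ∑ l ∈ idx s q.2, f ((q.1 + 2) :: l) := by
  rw [idx, Finset.sum_biUnion]
  · refine Finset.sum_congr rfl fun q _ => ?_
    rw [Finset.sum_image]
    intro l _ l' _ h
    simpa using h
  · intro q hq q' hq' hne
    simp only [Finset.mem_coe, Finset.HasAntidiagonal.mem_antidiagonal] at hq hq'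
    rw [Function.onFun, Finset.disjoint_left]
    intro l hl hl'
    rw [Finset.mem_image] at hl hl'
    obtain ⟨m, -, rfl⟩ := hl
    obtain ⟨m', -, h⟩ := hl'
    simp only [List.cons.injEq, Nat.add_right_cancel_iff] at h
    refine hne (Prod.ext ?_ ?_) <;> omega

/-- The sum of `f` over the sequences counted by the monomial `uⁿ wʲ`. -/
def genCoeff (f : List ℕ → ℝ[X]) (n j : ℕ) : ℝ[X] :=
  if Even j then ∑ l ∈ idx (j / 2) n, f l else 0

/-- The generating series of `f` over all sequences with entries at least `2`. -/
def gen (f : List ℕ → ℝ[X]) : Ser := fun e => genCoeff f (e 0) (e 1)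

theorem coeff_gen (f : List ℕ → ℝ[X]) (e : Fin 2 →₀ ℕ) :
    MvPowerSeries.coeff e (gen f) = genCoeff f (e 0) (e 1) := rfl

theorem gen_add (f g : List ℕ → ℝ[X]) : gen (fun l => f l + g l) = gen f + gen g := by
  ext1 e
  rw [map_add, coeff_gen, coeff_gen, coeff_gen, genCoeff, genCoeff, genCoeff]
  split_ifs
  · exact Finset.sum_add_distrib
  · simp

theorem gen_mul (p : ℝ[X]) (f : List ℕ → ℝ[X]) : gen (fun l => p * f l) = const p * gen f := by
  ext1 e
  rw [const, MvPowerSeries.coeff_C_mul, coeff_gen, coeff_gen, genCoeff, genCoeff]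
  split_ifs
  · rw [Finset.mul_sum]
  · simp

theorem coeff_u_mul_gen (f : List ℕ → ℝ[X]) (e : Fin 2 →₀ ℕ) :
    MvPowerSeries.coeff e (u * gen f) = if 1 ≤ e 0 then genCoeff f (e 0 - 1) (e 1) else 0 := by
  classical
  rw [u, MvPowerSeries.X, MvPowerSeries.coeff_monomial_mul, one_mul, coeff_gen]
  simp only [Finsupp.single_le_iff]
  simp

theorem coeff_w_sq_mul_gen (f : List ℕ → ℝ[X]) (e : Fin 2 →₀ ℕ) :
    MvPowerSeries.coeff e (w ^ 2 * gen f)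
      = if 2 ≤ e 1 then genCoeff f (e 0) (e 1 - 2) else 0 := by
  classical
  rw [w, MvPowerSeries.X_pow_eq, MvPowerSeries.coeff_monomial_mul, one_mul, coeff_gen]
  simp only [Finsupp.single_le_iff]
  simp

/-- The first entry contributes `∑_{a ≥ 2} x^a u^(a-2) w²`, and multiplication by `1 - xu` collapses
this geometric series to `x² w²`. -/
theorem one_sub_mul_gen {f g : List ℕ → ℝ[X]} {x : ℝ} (h0 : f [] = 0)
    (h : ∀ a l, f (a :: l) = C (x ^ a) * g l) :
    (1 - const (C x) * u) * gen f = const (C x) ^ 2 * (w ^ 2 * gen g) := by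
  have hsum : ∀ s n, ∑ l ∈ idx (s + 1) n, f l
      = ∑ q ∈ Finset.HasAntidiagonal.antidiagonal n, C x ^ (q.1 + 2) * ∑ l ∈ idx s q.2, g l := by
    intro s n
    simp only [sum_idx_succ, h, Finset.mul_sum, map_pow]
  ext1 e
  rw [sub_mul, one_mul, mul_assoc, map_sub, const, ← map_pow, MvPowerSeries.coeff_C_mul,
    MvPowerSeries.coeff_C_mul, coeff_u_mul_gen, coeff_w_sq_mul_gen, coeff_gen]
  generalize e 0 = n
  generalize e 1 = j
  by_cases hj : Even j
  · obtain ⟨s, rfl⟩ := hj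
    rw [← two_mul]
    cases s with
    | zero =>
      have : ∀ n, genCoeff f n (2 * 0) = 0 := by
        intro n
        rw [genCoeff, if_pos (by simp), mul_zero, Nat.zero_div, idx]
        split_ifs <;> simp [h0]
      simp only [this]
      simp
    | succ s =>
      have h1 : ∀ n, genCoeff f n (2 * (s + 1)) = ∑ l ∈ idx (s + 1) n, f l := by
        intro n
        rw [genCoeff, if_pos (by simp), Nat.mul_div_cancel_left _ two_pos]
      have h2 : genCoeff g n (2 * (s + 1) - 2) = ∑ l ∈ idx s n, g l := by
        rw [show 2 * (s + 1) - 2 = 2 * s by omega, genCoeff, if_pos (by simp),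
          Nat.mul_div_cancel_left _ two_pos]
      rw [h1, h1, h2, if_pos (show 2 ≤ 2 * (s + 1) by omega), hsum, hsum]
      cases n with
      | zero => simp
      | succ n =>
        have h3 : ∑ q ∈ Finset.HasAntidiagonal.antidiagonal n,
              C x ^ (q.1 + 1 + 2) * ∑ l ∈ idx s q.2, g l
            = C x * ∑ q ∈ Finset.HasAntidiagonal.antidiagonal n,
              C x ^ (q.1 + 2) * ∑ l ∈ idx s q.2, g l := by
          rw [Finset.mul_sum]
          refine Finset.sum_congr rfl fun q _ => ?_
          ring
        -- Terms with first entry above 2 are `x` times those with one less `u` and cancel; only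
        -- first entry 2 survives.
        rw [Finset.Nat.sum_antidiagonal_succ, if_pos (by omega), Nat.add_sub_cancel, h3,
          add_sub_cancel_right, zero_add]
  · have h1 : ∀ n, genCoeff f n j = 0 := fun n => by rw [genCoeff, if_neg hj]
    have h2 : 2 ≤ j → genCoeff g n (j - 2) = 0 := fun h => by
      rw [genCoeff, if_neg]
      rwa [Nat.even_sub h, iff_true_right even_two]
    rw [h1, h1]
    simp +contextual [h2]

/-! ### The product recursion and its logarithmic derivative. -/

theorem quad_mul_gen_succ (M : ℕ) :
    quad X (((M : ℝ) + 1)⁻¹) * gen (truncTmzv (M + 1))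
      = quad (X - 1) (((M : ℝ) + 1)⁻¹) * gen (truncTmzv M) := by
  have h1 : gen (truncTmzv (M + 1)) = gen (truncTmzv M) + gen (topTmzv M) := by
    rw [← gen_add]
    congr 1
    funext l
    exact truncTmzv_succ M l
  have h2 := one_sub_mul_gen (f := topTmzv M) (x := ((M : ℝ) + 1)⁻¹) rfl (topTmzv_cons M)
  rw [gen_add, gen_mul] at h2
  have h3 : const (X - 1) = const X - 1 := by simp [const]
  rw [h1, quad, quad, h3]
  linear_combination h2

/-- The sum of the series of differences of power sums, scaled by `1, 1/2, …, 1/M`. -/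
def truncDiff (M : ℕ) : Ser :=
  ∑ m ∈ Finset.range M,
    (powSumSeries X (((m : ℝ) + 1)⁻¹) - powSumSeries (X - 1) (((m : ℝ) + 1)⁻¹))

theorem gen_truncTmzv_zero : gen (truncTmzv 0) = 1 := by
  have h : ∀ a l, truncTmzv 0 (a :: l) = 0 := fun a l => by
    rw [truncTmzv, fillSum_congr (ψ' := fun _ => 0)]
    · simp [fillSum]
    · simp [truncMzv]
  classical
  ext1 e
  rw [coeff_gen, genCoeff, MvPowerSeries.coeff_one]
  have he : e = 0 ↔ e 0 = 0 ∧ e 1 = 0 := by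
    simp [Finsupp.ext_iff]
  simp only [he]
  generalize e 0 = n
  generalize e 1 = j
  by_cases hj : Even j
  · obtain ⟨s, rfl⟩ := hj
    rw [← two_mul, if_pos (by simp), Nat.mul_div_cancel_left _ two_pos]
    cases s with
    | zero =>
      rw [idx]
      split_ifs <;> simp_all [truncTmzv]
    | succ s =>
      rw [sum_idx_succ]
      simp [h]
  · rw [if_neg hj, if_neg]
    rintro ⟨-, rfl⟩
    simp at hj

theorem eulerD_gen_truncTmzv (M : ℕ) :
    eulerD (gen (truncTmzv M)) = gen (truncTmzv M) * truncDiff M := by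
  induction M with
  | zero => rw [gen_truncTmzv_zero, eulerD_one, truncDiff, Finset.sum_range_zero, mul_zero]
  | succ M ih =>
    rw [eulerD_of_quad_mul_eq ih (quad_mul_gen_succ M), truncDiff, truncDiff, Finset.sum_range_succ]

theorem coeff_truncDiff (M : ℕ) (e : Fin 2 →₀ ℕ) :
    MvPowerSeries.coeff e (truncDiff M)
      = C (∑ m ∈ Finset.range M, ((m : ℝ) + 1)⁻¹ ^ e.degree)
        * MvPowerSeries.coeff e (powDiff e.degree) := by
  rw [truncDiff, map_sum, map_sum, Finset.sum_mul]
  refine Finset.sum_congr rfl fun m _ => ?_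
  rw [powDiff, map_sub, map_sub, powSumSeries, powSumSeries, coeff_graded, coeff_graded, const,
    MvPowerSeries.coeff_C_mul, MvPowerSeries.coeff_C_mul, mul_sub]

/-! ### Convergence of the truncated sums. -/

open Filter Topology

theorem truncMzv_nonneg (l : List ℕ) (M : ℕ) : 0 ≤ truncMzv l M := by
  induction l generalizing M with
  | nil => simp [truncMzv]
  | cons k l ih =>
    rw [truncMzv]
    exact Finset.sum_nonneg fun m _ => mul_nonneg (by positivity) (ih m)

theorem summable_inv_add_one_pow {n : ℕ} (hn : 2 ≤ n) :
    Summable fun m : ℕ => ((m : ℝ) + 1)⁻¹ ^ n := by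
  have h := (summable_nat_add_iff 1).2 (Real.summable_one_div_nat_pow.2 (show 1 < n by omega))
  refine h.congr fun m => ?_
  push_cast
  rw [inv_pow, one_div]

theorem tendsto_sum_zetaVal {n : ℕ} (hn : 2 ≤ n) :
    Tendsto (fun M => ∑ m ∈ Finset.range M, ((m : ℝ) + 1)⁻¹ ^ n) atTop (𝓝 (zetaVal n)) := by
  have h : zetaVal n = ∑' m : ℕ, ((m : ℝ) + 1)⁻¹ ^ n := by
    have h1 : riemannZeta (n : ℂ) = ((∑' m : ℕ, 1 / (m : ℝ) ^ n : ℝ) : ℂ) := by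
      rw [zeta_nat_eq_tsum_of_gt_one (by omega)]
      push_cast
      rfl
    rw [zetaVal, h1, Complex.ofReal_re,
      (Real.summable_one_div_nat_pow.2 (show 1 < n by omega)).tsum_eq_zero_add]
    rw [Nat.cast_zero, zero_pow (by omega), div_zero, zero_add]
    refine tsum_congr fun m => ?_
    push_cast
    rw [inv_pow, one_div]
  rw [h]
  exact (summable_inv_add_one_pow hn).hasSum.tendsto_sum_nat

/-- The bound is uniform in `M`, which is what summability of the full series needs. -/
theorem truncMzv_le {l : List ℕ} (hl : ∀ a ∈ l, 2 ≤ a) (M : ℕ) :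
    truncMzv l M ≤ (∑' m : ℕ, ((m : ℝ) + 1)⁻¹ ^ 2) ^ l.length := by
  induction l generalizing M with
  | nil => simp [truncMzv]
  | cons k l ih =>
    rw [List.forall_mem_cons] at hl
    have h0 : 0 ≤ (∑' m : ℕ, ((m : ℝ) + 1)⁻¹ ^ 2) := tsum_nonneg fun m => by positivity
    rw [truncMzv, List.length_cons, pow_succ']
    calc _ ≤ ∑ m ∈ Finset.range M, ((m : ℝ) + 1)⁻¹ ^ 2
              * (∑' m : ℕ, ((m : ℝ) + 1)⁻¹ ^ 2) ^ l.length := by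
          refine Finset.sum_le_sum fun m _ => ?_
          refine mul_le_mul ?_ (ih hl.2 m) (truncMzv_nonneg l m) (by positivity)
          exact pow_le_pow_of_le_one (by positivity)
            (inv_le_one_of_one_le₀ (by linarith [(Nat.cast_nonneg m : (0 : ℝ) ≤ m)])) hl.1
      _ ≤ _ := by
          rw [← Finset.sum_mul]
          refine mul_le_mul_of_nonneg_right ?_ (pow_nonneg h0 _)
          exact (summable_inv_add_one_pow le_rfl).sum_le_tsum _ fun m _ => by positivity

/-- The strictly decreasing sequences of `n` positive integers at most `M`. -/
def decSeq (n M : ℕ) : Finset (Fin n → ℕ) :=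
  open Classical in
  (Fintype.piFinset fun _ : Fin n => Finset.Icc 1 M).filter fun m => StrictAnti m

theorem mem_decSeq {n M : ℕ} {m : Fin n → ℕ} :
    m ∈ decSeq n M ↔ StrictAnti m ∧ (∀ i, 0 < m i) ∧ ∀ i, m i ≤ M := by
  classical
  simp only [decSeq, Finset.mem_filter, Fintype.mem_piFinset, Finset.mem_Icc, Nat.succ_le_iff,
    forall_and]
  tauto

theorem mem_decSeq_cons {n M a : ℕ} {m : Fin n → ℕ} :
    Fin.cons (α := fun _ => ℕ) a m ∈ decSeq (n + 1) M ↔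
      (0 < a ∧ a ≤ M) ∧ m ∈ decSeq n (a - 1) := by
  rw [mem_decSeq, mem_decSeq, Fin.forall_fin_succ, Fin.forall_fin_succ]
  simp only [Fin.cons_zero, Fin.cons_succ]
  constructor
  · rintro ⟨h1, ⟨h2, h3⟩, h4, h5⟩
    refine ⟨⟨h2, h4⟩, fun i j hij => ?_, h3, fun i => ?_⟩
    · simpa using h1 (Fin.succ_lt_succ_iff.2 hij)
    · have := h1 (Fin.succ_pos i)
      simp only [Fin.cons_zero, Fin.cons_succ] at this
      omega
  · rintro ⟨⟨h1, h2⟩, h3, h4, h5⟩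
    refine ⟨fun i j => ?_, ⟨h1, h4⟩, h2, fun i => ?_⟩
    · refine Fin.cases (fun hj => absurd hj (by simp)) (fun j => ?_) j
      refine Fin.cases (fun _ => ?_) (fun i hij => ?_) i
      · have := h5 j
        simp only [Fin.cons_zero, Fin.cons_succ]
        omega
      · simpa using h3 (Fin.succ_lt_succ_iff.1 hij)
    · have := h5 i
      omega

/-- The largest variable is split off; the range index `m` stands for the value `m + 1`, so the
other variables are at most `m`. -/
theorem truncMzv_eq_sum (l : List ℕ) (M : ℕ) :
    truncMzv l M = ∑ m ∈ decSeq l.length M, ∏ i, 1 / ((m i : ℝ) ^ l.get i) := by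
  induction l generalizing M with
  | nil =>
    have h : decSeq ([] : List ℕ).length M = {Fin.elim0} := by
      ext m
      simp only [Finset.mem_singleton, mem_decSeq]
      exact ⟨fun _ => funext fun i => i.elim0,
        fun _ => ⟨fun i => i.elim0, fun i => i.elim0, fun i => i.elim0⟩⟩
    rw [h]
    simp [truncMzv]
  | cons k l ih =>
    simp only [truncMzv, ih, Finset.mul_sum]
    rw [Finset.sum_sigma']
    refine Finset.sum_bij' (fun q _ => Fin.cons (α := fun _ => ℕ) (q.1 + 1) q.2)
      (fun m _ => ⟨m 0 - 1, fun i => m i.succ⟩) ?_ ?_ ?_ ?_ ?_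
    · rintro ⟨a, m⟩ h
      rw [Finset.mem_sigma, Finset.mem_range] at h
      refine mem_decSeq_cons.2 ⟨⟨by omega, ?_⟩, ?_⟩
      · exact h.1
      · simpa using h.2
    · intro m h
      rw [← Fin.cons_self_tail m] at h
      have h1 := mem_decSeq_cons.1 h
      rw [Finset.mem_sigma, Finset.mem_range]
      exact ⟨by dsimp only; omega, h1.2⟩
    · rintro ⟨a, m⟩ h
      simp
    · intro m h
      have h1 := (mem_decSeq.1 h).2.1 0
      rw [Nat.sub_add_cancel h1]
      exact Fin.cons_self_tail m
    · rintro ⟨a, m⟩ h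
      simp only [List.length_cons]
      rw [Fin.prod_univ_succ]
      simp

theorem decSeq_mono (n : ℕ) : Monotone (decSeq n) := by
  intro M N h m hm
  rw [mem_decSeq] at hm ⊢
  exact ⟨hm.1, hm.2.1, fun i => (hm.2.2 i).trans h⟩

theorem tendsto_truncMzv {l : List ℕ} (hl : ∀ a ∈ l, 2 ≤ a) :
    Tendsto (truncMzv l) atTop (𝓝 (mzv l)) := by
  classical
  let P : (Fin l.length → ℕ) → Prop := fun m => StrictAnti m ∧ ∀ i, 0 < m i
  let f : {m // P m} → ℝ := fun m => ∏ i, 1 / ((m.1 i : ℝ) ^ l.get i)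
  let F : ℕ → Finset {m // P m} := fun M => (decSeq l.length M).subtype P
  have hF : Monotone F := fun M N h => Finset.subtype_mono (decSeq_mono _ h)
  have hmem : ∀ m, ∃ M, m ∈ F M := fun m =>
    -- The sum of the entries is a crude upper bound for each of them.
    ⟨∑ i, m.1 i, Finset.mem_subtype.2 (mem_decSeq.2 ⟨m.2.1, m.2.2, fun i =>
      Finset.single_le_sum (f := m.1) (fun _ _ => Nat.zero_le _) (Finset.mem_univ i)⟩)⟩
  have hsum : ∀ M, ∑ m ∈ F M, f m = truncMzv l M := by
    intro M
    rw [truncMzv_eq_sum, Finset.sum_subtype_of_mem (p := P)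
      (f := fun m : Fin l.length → ℕ => ∏ i, 1 / ((m i : ℝ) ^ l.get i))]
    intro m hm
    exact ⟨(mem_decSeq.1 hm).1, (mem_decSeq.1 hm).2.1⟩
  have hf0 : ∀ m, 0 ≤ f m := fun m => Finset.prod_nonneg fun i _ => by positivity
  have htends := hF.tendsto_atTop_finset hmem
  have hsummable : Summable f := by
    refine summable_of_sum_le hf0
      (c := (∑' m : ℕ, ((m : ℝ) + 1)⁻¹ ^ 2) ^ l.length) fun s => ?_
    obtain ⟨M, hM⟩ := (htends.eventually_ge_atTop s).exists
    exact (Finset.sum_le_sum_of_subset_of_nonneg hM fun m _ _ => hf0 m).trans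
      ((hsum M).trans_le (truncMzv_le hl M))
  have h := hsummable.hasSum.comp htends
  exact h.congr hsum

/-! ### Passage to the limit and the exponential formula. -/

/-- `tmzv` with the value `1` at the empty sequence. -/
def tmzvOne : List ℕ → ℝ[X]
  | [] => 1
  | a :: l => tmzv (a :: l)

theorem two_le_of_mem_fillings {l : List ℕ} {a : ℕ} (ha : 2 ≤ a) (hl : ∀ b ∈ l, 2 ≤ b)
    {p : List ℕ} (hp : p ∈ fillings a l) : ∀ b ∈ p, 2 ≤ b := by
  induction l generalizing a p with
  | nil => simp_all [fillings]
  | cons b l ih =>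
    rw [List.forall_mem_cons] at hl
    rw [fillings, List.mem_append, List.mem_map] at hp
    rcases hp with ⟨q, hq, rfl⟩ | hp
    · exact List.forall_mem_cons.2 ⟨ha, ih hl.1 hl.2 hq⟩
    · exact ih (by omega) hl.2 hp

theorem tendsto_eval_truncTmzv (τ : ℝ) {l : List ℕ} (hl : ∀ a ∈ l, 2 ≤ a) :
    Tendsto (fun M => (truncTmzv M l).eval τ) atTop (𝓝 ((tmzvOne l).eval τ)) := by
  cases l with
  | nil => exact tendsto_const_nhds
  | cons a l =>
    rw [List.forall_mem_cons] at hl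
    simp only [truncTmzv, fillSum, tmzvOne, tmzv, ← coe_evalRingHom, map_list_sum, List.map_map]
    refine tendsto_list_sum _ fun p hp => ?_
    simp only [Function.comp_apply, coe_evalRingHom, eval_mul, eval_C]
    exact (tendsto_truncMzv (two_le_of_mem_fillings hl.1 hl.2 hp)).const_mul _

theorem tendsto_eval_coeff_gen (τ : ℝ) (e : Fin 2 →₀ ℕ) :
    Tendsto (fun M => (MvPowerSeries.coeff e (gen (truncTmzv M))).eval τ) atTop
      (𝓝 ((MvPowerSeries.coeff e (gen tmzvOne)).eval τ)) := by
  simp only [coeff_gen, genCoeff]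
  split_ifs
  · simp only [eval_finsetSum]
    exact tendsto_finsetSum _ fun l hl => tendsto_eval_truncTmzv τ (mem_idx.1 hl).2.2
  · exact tendsto_const_nhds

/-- The Euler derivative of the exponent. -/
def zetaDiff : Ser := graded fun n => const (C (zetaVal n)) * powDiff n

theorem coeff_zetaDiff (e : Fin 2 →₀ ℕ) : MvPowerSeries.coeff e zetaDiff
    = C (zetaVal e.degree) * MvPowerSeries.coeff e (powDiff e.degree) := by
  rw [zetaDiff, coeff_graded, const, MvPowerSeries.coeff_C_mul]

theorem powDiff_of_lt_two {n : ℕ} (h : n < 2) : powDiff n = 0 := by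
  interval_cases n
  · exact powDiff_zero
  · exact powDiff_one

theorem tendsto_eval_coeff_truncDiff (τ : ℝ) (e : Fin 2 →₀ ℕ) :
    Tendsto (fun M => (MvPowerSeries.coeff e (truncDiff M)).eval τ) atTop
      (𝓝 ((MvPowerSeries.coeff e zetaDiff).eval τ)) := by
  rw [coeff_zetaDiff, eval_mul, eval_C]
  have h1 : ∀ M, (MvPowerSeries.coeff e (truncDiff M)).eval τ
      = (∑ m ∈ Finset.range M, ((m : ℝ) + 1)⁻¹ ^ e.degree)
        * (MvPowerSeries.coeff e (powDiff e.degree)).eval τ := fun M => by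
    rw [coeff_truncDiff, eval_mul, eval_C]
  refine Tendsto.congr (fun M => (h1 M).symm) ?_
  by_cases h : 2 ≤ e.degree
  · exact (tendsto_sum_zetaVal h).mul_const _
  -- In degrees 0 and 1 the sums over `m` diverge, but their factor `powDiff` is zero.
  · rw [powDiff_of_lt_two (not_le.1 h), map_zero, eval_zero, mul_zero]
    simp only [mul_zero]
    exact tendsto_const_nhds

theorem eulerD_gen_tmzvOne : eulerD (gen tmzvOne) = gen tmzvOne * zetaDiff := by
  classical
  ext1 e
  -- A real polynomial is determined by its values, so limits need only be taken in `ℝ`, at each `t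
  -- = τ`.
  refine Polynomial.funext fun τ => ?_
  have h1 : Tendsto (fun M => (MvPowerSeries.coeff e (eulerD (gen (truncTmzv M)))).eval τ) atTop
      (𝓝 ((MvPowerSeries.coeff e (eulerD (gen tmzvOne))).eval τ)) := by
    simp only [coeff_eulerD, eval_mul]
    exact (tendsto_eval_coeff_gen τ e).const_mul _
  refine tendsto_nhds_unique h1 ?_
  simp only [eulerD_gen_truncTmzv, MvPowerSeries.coeff_mul, eval_finsetSum, eval_mul]
  exact tendsto_finsetSum _ fun p _ =>
    (tendsto_eval_coeff_gen τ p.1).mul (tendsto_eval_coeff_truncDiff τ p.2)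

/-- The exponent `∑ ζ(n) / n (αⁿ + βⁿ - δ₁ⁿ - δ₂ⁿ)`. -/
def zetaLog : Ser := graded fun n => const (C (zetaVal n / n)) * powDiff n

theorem constantCoeff_zetaLog : MvPowerSeries.constantCoeff zetaLog = 0 := by
  rw [← MvPowerSeries.coeff_zero_eq_constantCoeff_apply, zetaLog, coeff_graded]
  simp [powDiff_zero]

theorem eulerD_zetaLog : eulerD zetaLog = zetaDiff := by
  ext1 e
  rw [coeff_eulerD, zetaLog, zetaDiff, coeff_graded, coeff_graded, const, const,
    MvPowerSeries.coeff_C_mul, MvPowerSeries.coeff_C_mul, ← mul_assoc]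
  by_cases h : e.degree = 0
  · simp [h, powDiff_zero]
  · rw [← map_natCast (C (R := ℝ)), ← map_mul, mul_div_cancel₀ _ (Nat.cast_ne_zero.2 h)]

theorem gen_tmzvOne : gen tmzvOne = fexp zetaLog := by
  have h0 := constantCoeff_zetaLog
  refine eq_of_eulerD_eq_mul (E := zetaDiff) ?_ ?_ eulerD_gen_tmzvOne ?_
  · rw [← eulerD_zetaLog, ← MvPowerSeries.coeff_zero_eq_constantCoeff_apply, coeff_eulerD]
    simp
  · rw [constantCoeff_fexp h0, ← MvPowerSeries.coeff_zero_eq_constantCoeff_apply, coeff_gen]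
    simp [genCoeff, idx, tmzvOne]
  · rw [eulerD_fexp h0, eulerD_zetaLog]

/-! ### The sums `X₀` as coefficients, and the two formal sums. -/

/-- Height equal to depth forces all entries to be at least 2; admissibility is then automatic
because `s ≥ 1` excludes the empty sequence. -/
theorem X₀_eq_sum_idx {k s : ℕ} (hs : 1 ≤ s) (hk : 2 * s ≤ k) :
    X₀ k s s = ∑ l ∈ idx s (k - 2 * s), tmzvOne l := by
  classical
  rw [X₀]
  refine Finset.sum_bij (fun c _ => c.blocks) ?_ ?_ ?_ ?_
  · intro c hc
    obtain ⟨-, h1, h2⟩ := (Finset.mem_filter.1 hc).2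
    rw [mem_idx, c.blocks_sum]
    refine ⟨h1, by omega, fun a ha => ?_⟩
    rw [height, ← h1, List.countP_eq_length] at h2
    simpa using h2 a ha
  · intro c _ c' _ h
    exact Composition.ext h
  · intro l hl
    obtain ⟨h1, h2, h3⟩ := mem_idx.1 hl
    refine ⟨⟨l, fun {a} ha => lt_of_lt_of_le two_pos (h3 a ha), by omega⟩, ?_, rfl⟩
    refine Finset.mem_filter.2 ⟨Finset.mem_univ _, ?_, h1, ?_⟩
    · cases l with
      | nil =>
        simp only [List.length_nil] at h1
        omega
      | cons a l => exact ⟨a, l, rfl, h3 a (by simp)⟩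
    · refine Eq.trans (List.countP_eq_length.2 ?_) h1
      simpa using h3
  · intro c hc
    obtain ⟨⟨a, l, h, -⟩, -⟩ := (Finset.mem_filter.1 hc).2
    rw [h, tmzvOne]

theorem X₀_eq_genCoeff {k s : ℕ} (hs : 1 ≤ s) (hk : 2 * s ≤ k) :
    X₀ k s s = genCoeff tmzvOne (k - 2 * s) (2 * s) := by
  rw [X₀_eq_sum_idx hs hk, genCoeff, if_pos (by simp), Nat.mul_div_cancel_left _ two_pos]

theorem coeff_const_mul_u_pow_mul_w_pow (p : ℝ[X]) (a b : ℕ) (e : Fin 2 →₀ ℕ) :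
    MvPowerSeries.coeff e (const p * u ^ a * w ^ b) = if e 0 = a ∧ e 1 = b then p else 0 := by
  classical
  rw [mul_assoc, const, MvPowerSeries.coeff_C_mul, u, w, MvPowerSeries.X_pow_eq,
    MvPowerSeries.X_pow_eq, MvPowerSeries.monomial_mul_monomial, MvPowerSeries.coeff_monomial]
  have h : e = Finsupp.single 0 a + Finsupp.single 1 b ↔ e 0 = a ∧ e 1 = b := by
    simp [Finsupp.ext_iff]
  simp [h]

theorem formalHasSum_X₀ : FormalHasSum
    (fun p : {p : ℕ × ℕ // 2 * p.2 ≤ p.1 ∧ 1 ≤ p.2} =>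
      const (X₀ p.1.1 p.1.2 p.1.2) * u ^ (p.1.1 - 2 * p.1.2) * w ^ (2 * p.1.2))
    (gen tmzvOne - 1) := by
  classical
  intro e
  simp only [coeff_const_mul_u_pow_mul_w_pow]
  have hval : ∀ p : {p : ℕ × ℕ // 2 * p.2 ≤ p.1 ∧ 1 ≤ p.2},
      (e 0 = p.1.1 - 2 * p.1.2 ∧ e 1 = 2 * p.1.2) → p.1 = (e 0 + e 1, e 1 / 2) := by
    rintro ⟨⟨k, s⟩, h1, h2⟩ ⟨h3, h4⟩
    simp only at h1 h2 h3 h4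
    refine Prod.ext ?_ ?_ <;> simp only <;> omega
  have hzero : ∀ n, genCoeff tmzvOne n 0 = if n = 0 then 1 else 0 := fun n => by
    rw [genCoeff, if_pos (by simp), Nat.zero_div, idx]
    split_ifs <;> simp [tmzvOne]
  -- A monomial determines `k` and `s`, so at most one member of the family contributes to it.
  refine ⟨Set.Subsingleton.finite fun p hp q hq => ?_, ?_⟩
  · have h1 := hval p (by by_contra h; exact hp (if_neg h))
    have h2 := hval q (by by_contra h; exact hq (if_neg h))
    exact Subtype.ext (h1.trans h2.symm)
  · have he : e = 0 ↔ e 0 = 0 ∧ e 1 = 0 := by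
      simp [Finsupp.ext_iff]
    rw [map_sub, coeff_gen, MvPowerSeries.coeff_one]
    simp only [he]
    by_cases h : Even (e 1) ∧ 1 ≤ e 1
    · obtain ⟨⟨s, hs⟩, h1⟩ := h
      have hs1 : 1 ≤ s := by omega
      rw [finsum_eq_single _ ⟨(e 0 + 2 * s, s), by simp, hs1⟩]
      · dsimp only
        rw [if_pos ⟨by omega, by omega⟩, if_neg (by omega), sub_zero,
          X₀_eq_genCoeff hs1 (by omega), hs, Nat.add_sub_cancel, two_mul]
      · intro p hp
        rw [if_neg]
        intro h
        refine hp (Subtype.ext ?_)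
        rw [hval p h]
        refine Prod.ext ?_ ?_ <;> simp only <;> omega
    -- No pair contributes here: `gen tmzvOne` has odd powers of `w` with coefficient zero, and its
    -- part without `w` is the empty sequence's 1, which is subtracted.
    · rw [finsum_eq_zero_of_forall_eq_zero]
      · rw [not_and_or] at h
        by_cases h0 : e 1 = 0
        · rw [h0, hzero]
          simp
        · rw [genCoeff, if_neg (by rcases h with h | h; exacts [h, by omega]), if_neg (by simp [h0]),
            sub_zero]
      · intro p
        rw [if_neg]
        rintro ⟨-, h3⟩
        have := p.2.2
        exact h ⟨by rw [h3]; simp, by omega⟩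

theorem formalHasSum_zetaLog : FormalHasSum
    (fun n : {n : ℕ // 2 ≤ n} => const (C (zetaVal n / (n : ℕ))) * powDiff n) zetaLog := by
  intro e
  have h0 : ∀ n : ℕ, n ≠ e.degree →
      MvPowerSeries.coeff e (const (C (zetaVal n / n)) * powDiff n) = 0 := fun n hn => by
    rw [const, MvPowerSeries.coeff_C_mul, isHomog_powDiff n e hn.symm, mul_zero]
  refine ⟨Set.Subsingleton.finite fun p hp q hq => Subtype.ext ?_, ?_⟩
  · have h1 : (p : ℕ) = e.degree := by by_contra h; exact hp (h0 _ h)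
    have h2 : (q : ℕ) = e.degree := by by_contra h; exact hq (h0 _ h)
    rw [h1, h2]
  · by_cases h : 2 ≤ e.degree
    · rw [finsum_eq_single _ ⟨e.degree, h⟩]
      · rw [zetaLog, coeff_graded]
      · intro n hn
        exact h0 _ fun h => hn (Subtype.ext h)
    · rw [finsum_eq_zero_of_forall_eq_zero]
      · rw [zetaLog, coeff_graded, powDiff_of_lt_two (not_le.1 h), mul_zero, map_zero]
      · intro n
        exact h0 _ fun hn => h (hn ▸ n.2)

/-! ### Polynomiality in the zeta values, and the roots. -/

/-- The series all of whose coefficients lie in a subring. -/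
def coeffSubring (S : Subring ℝ[X]) : Subring Ser where
  carrier := {F | ∀ e, MvPowerSeries.coeff e F ∈ S}
  mul_mem' := fun {F G} hF hG e => by
    classical
    rw [MvPowerSeries.coeff_mul]
    exact S.sum_mem fun p _ => S.mul_mem (hF _) (hG _)
  one_mem' := fun e => by
    classical
    rw [MvPowerSeries.coeff_one]
    split_ifs
    exacts [S.one_mem, S.zero_mem]
  add_mem' := fun {F G} hF hG e => by
    rw [map_add]
    exact S.add_mem (hF e) (hG e)
  zero_mem' := fun e => by
    rw [map_zero]
    exact S.zero_mem
  neg_mem' := fun {F} hF e => by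
    rw [map_neg]
    exact S.neg_mem (hF e)

theorem const_mem_coeffSubring {S : Subring ℝ[X]} {p : ℝ[X]} (hp : p ∈ S) :
    const p ∈ coeffSubring S := fun e => by
  classical
  rw [const, MvPowerSeries.coeff_C]
  split_ifs
  exacts [hp, S.zero_mem]

theorem X_mem_coeffSubring (S : Subring ℝ[X]) (i : Fin 2) :
    (MvPowerSeries.X i : Ser) ∈ coeffSubring S := fun e => by
  classical
  rw [MvPowerSeries.coeff_X]
  split_ifs
  exacts [S.one_mem, S.zero_mem]

theorem powSum_mem_coeffSubring {S : Subring ℝ[X]} {p : ℝ[X]} (hp : p ∈ S) (n : ℕ) :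
    powSum p n ∈ coeffSubring S := by
  have hu : u ∈ coeffSubring S := X_mem_coeffSubring S 0
  have hw : w ∈ coeffSubring S := X_mem_coeffSubring S 1
  induction n using Nat.twoStepInduction with
  | zero => exact ofNat_mem (coeffSubring S) 2
  | one => exact hu
  | more n h1 h2 =>
    exact add_mem (mul_mem hu h2)
      (mul_mem (mul_mem (const_mem_coeffSubring hp) (pow_mem hw 2)) h1)

/-- The polynomials in the zeta values with coefficients in `ℚ[t]`. -/
def zetaSubring : Subring ℝ[X] :=
  (MvPolynomial.eval₂Hom (Polynomial.mapRingHom (algebraMap ℚ ℝ))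
    (fun m : {m : ℕ // 2 ≤ m} => C (zetaVal m))).range

theorem map_mem_zetaSubring (p : ℚ[X]) : p.map (algebraMap ℚ ℝ) ∈ zetaSubring :=
  ⟨MvPolynomial.C p, by simp⟩

theorem C_ratCast_mem_zetaSubring (q : ℚ) : C (q : ℝ) ∈ zetaSubring := by
  simpa using map_mem_zetaSubring (C q)

theorem X_mem_zetaSubring : (X : ℝ[X]) ∈ zetaSubring := by
  simpa using map_mem_zetaSubring X

theorem C_zetaVal_mem_zetaSubring {m : ℕ} (hm : 2 ≤ m) : C (zetaVal m) ∈ zetaSubring :=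
  ⟨MvPolynomial.X ⟨m, hm⟩, by simp⟩

theorem zetaLog_mem_coeffSubring : zetaLog ∈ coeffSubring zetaSubring := fun e => by
  rw [zetaLog, coeff_graded]
  by_cases h : 2 ≤ e.degree
  · have h1 : C (zetaVal e.degree / e.degree) ∈ zetaSubring := by
      rw [div_eq_mul_inv, map_mul]
      refine mul_mem (C_zetaVal_mem_zetaSubring h) ?_
      simpa using C_ratCast_mem_zetaSubring ((e.degree : ℚ)⁻¹)
    exact mul_mem (const_mem_coeffSubring h1)
      (sub_mem (powSum_mem_coeffSubring X_mem_zetaSubring _)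
        (powSum_mem_coeffSubring (sub_mem X_mem_zetaSubring (one_mem _)) _)) e
  · rw [powDiff_of_lt_two (not_le.1 h), mul_zero, map_zero]
    exact zero_mem _

/-- Each coefficient comes from a partial sum of the exponential, a polynomial in `zetaLog` with
rational coefficients. -/
theorem fexp_zetaLog_mem_coeffSubring : fexp zetaLog ∈ coeffSubring zetaSubring := fun e => by
  rw [coeff_fexp constantCoeff_zetaLog (Nat.lt_succ_self _)]
  refine sum_mem (S := coeffSubring zetaSubring) (fun d _ => mul_mem
    (const_mem_coeffSubring ?_) (pow_mem zetaLog_mem_coeffSubring d)) e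
  simpa using C_ratCast_mem_zetaSubring ((d.factorial : ℚ)⁻¹)

theorem X₀_mem_zetaSubring {k n : ℕ} (hn : 1 ≤ n) (hk : 2 * n ≤ k) : X₀ k n n ∈ zetaSubring := by
  have h := fexp_zetaLog_mem_coeffSubring
    (Finsupp.single 0 (k - 2 * n) + Finsupp.single 1 (2 * n))
  rw [← gen_tmzvOne, coeff_gen] at h
  rw [X₀_eq_genCoeff hn hk]
  simpa using h

theorem algebraMap_powDiff {B : Type*} [CommRing B] [Algebra Ser B] {α β δ₁ δ₂ : B}
    (h1 : α + β = algebraMap Ser B u) (h2 : α * β = algebraMap Ser B (-(t * w ^ 2)))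
    (h3 : δ₁ + δ₂ = algebraMap Ser B u) (h4 : δ₁ * δ₂ = algebraMap Ser B ((1 - t) * w ^ 2))
    (n : ℕ) : algebraMap Ser B (powDiff n) = α ^ n + β ^ n - δ₁ ^ n - δ₂ ^ n := by
  -- The pair `δ₁`, `δ₂` is the case `p = t - 1` of roots with product `-p w²`, as `α`, `β` is the
  -- case `p = t`.
  have h5 : (1 - t) * w ^ 2 = -(const (X - 1) * w ^ 2) := by
    rw [t, const, const, map_sub, map_one]
    ring
  rw [h5] at h4
  rw [powDiff, map_sub, map_powSum X h1 h2, map_powSum (X - 1) h3 h4]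
  ring

end TMZV

end

theorem mainTheorem4 :
    (∀ (B : Type*) [CommRing B] [Algebra TMZV.Ser B],
      Function.Injective (algebraMap TMZV.Ser B) →
      ∀ α β δ₁ δ₂ : B,
        α + β = algebraMap TMZV.Ser B TMZV.u →
        α * β = algebraMap TMZV.Ser B (-(TMZV.t * TMZV.w ^ 2)) →
        δ₁ + δ₂ = algebraMap TMZV.Ser B TMZV.u →
        δ₁ * δ₂ = algebraMap TMZV.Ser B ((1 - TMZV.t) * TMZV.w ^ 2) →
        ∃ (P : ℕ → TMZV.Ser) (L : TMZV.Ser),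
          (∀ n, 2 ≤ n → algebraMap TMZV.Ser B (P n) = α ^ n + β ^ n - δ₁ ^ n - δ₂ ^ n) ∧
          TMZV.FormalHasSum
            (fun n : {n : ℕ // 2 ≤ n} =>
              TMZV.const (Polynomial.C (TMZV.zetaVal n / (n : ℕ))) * P n) L ∧
          MvPowerSeries.constantCoeff L = 0 ∧
          TMZV.FormalHasSum
            (fun p : {p : ℕ × ℕ // 2 * p.2 ≤ p.1 ∧ 1 ≤ p.2} =>
              TMZV.const (TMZV.X₀ p.1.1 p.1.2 p.1.2)
                * TMZV.u ^ (p.1.1 - 2 * p.1.2) * TMZV.w ^ (2 * p.1.2))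
            (TMZV.fexp L - 1)) ∧
    (∀ k n : ℕ, 1 ≤ n → 2 * n ≤ k →
      ∃ Q : MvPolynomial {m : ℕ // 2 ≤ m} (Polynomial ℚ),
        TMZV.X₀ k n n =
          MvPolynomial.eval₂ (Polynomial.mapRingHom (algebraMap ℚ ℝ))
            (fun m : {m : ℕ // 2 ≤ m} => Polynomial.C (TMZV.zetaVal m)) Q) := by
  refine ⟨fun B _ _ _ α β δ₁ δ₂ h1 h2 h3 h4 => ⟨TMZV.powDiff, TMZV.zetaLog,
    fun n _ => TMZV.algebraMap_powDiff h1 h2 h3 h4 n, TMZV.formalHasSum_zetaLog,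
    TMZV.constantCoeff_zetaLog, ?_⟩, fun k n hn hk => ?_⟩
  · rw [← TMZV.gen_tmzvOne]
    exact TMZV.formalHasSum_X₀
  · obtain ⟨Q, hQ⟩ := TMZV.X₀_mem_zetaSubring hn hk
    exact ⟨Q, hQ.symm⟩
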